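/- Let $\mathcal{C}$ be a complete closed monoidal category with unit $\mathbb{1}$. Write $[A,-]$ for the right adjoint of $A\otimes-$, so that internal composition is a morphism $[X,Y]\otimes[Y,Z]\to[X,Z]$. (The convention with $-\otimes A\dashv[A,-]$ is obtained by reversing the tensor product.) For $f\colon X'\to X$ and $g\colon Y\to Y'$ write $[f,Y]\colon[X,Y]\to[X',Y]$ and $[X,g]\colon[X,Y]\to[X,Y']$ for the induced morphisms. **Internally adjoint pairs.** An internally adjoint comonad--monad pair $(T\dashv F)$ on $\mathcal{C}$ consists of a comonad $(T,\Delta,\varepsilon)$, a monad $(F,\mu,\eta)$ and an isomorphism of bifunctors $\kappa_{X,Y}\colon[TX,Y]\cong[X,FY]$. On global sections $\kappa$ induces an ordinary adjunction $T\dashv F$, with unit $\iota$ and counit $\epsilon$; it also induces actions on hom objects $$T_{X,Y}\colon[X,Y]\xrightarrow{[X,\iota_Y]}[X,FTY]\cong[TX,TY],\qquad F_{X,Y}\colon[X,Y]\xrightarrow{[\epsilon_X,Y]}[TFX,Y]\cong[FX,FY].$$ It is required that $\kappa$ is $\mathcal{C}$-natural in both variables with respect to these actions (i.e. compatible with internal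 composition), that $\Delta$ and $\varepsilon$ are $\mathcal{C}$-natural, and that $\mu,\eta$ correspond to $\Delta,\varepsilon$ under the adjunction $T\dashv F$. **Comodules and contramodules.** Let $\mathcal{C}_T$ be the class of $T$-comodules $(X,\rho_X\colon X\to TX)$ and $\mathcal{C}^F$ the class of $F$-modules (contramodules) $(Y,\theta_Y\colon FY\to Y)$. They are $\mathcal{C}$-enriched categories: $[X,Y]_T\subseteq[X,Y]$ is the equaliser of $[X,\rho_Y]$ and $[\rho_X,TY]\circ T_{X,Y}\colon[X,Y]\rightrightarrows[X,TY]$, and $[X,Y]^F\subseteq[X,Y]$ is the equaliser of $[FX,\theta_Y]\circ F_{X,Y}$ and $[\theta_X,Y]\colon[X,Y]\rightrightarrows[FX,Y]$, with composition and identities inherited from $\mathcal{C}$. Let $C=T\mathbb{1}$, a $T$-comodule via $\Delta_{\mathbb{1}}$, and let $i_X\colon[C,X]_T\to[C,X]\cong[\mathbb{1},FX]\cong FX$ be the canonical morphism. **Theorem.** Let $(T\dashv F)$ be an internally adjoint comonad--monad pair on a complete closed monoidal category $\mathcal{C}$. 1. There is a $\mathcal{C}$-enriched functor $R\colon\mathcal{C}_T\to\mathcal{C}^F$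 with $RX=[C,X]_T$, whose structure morphism satisfies $i_X\circ\theta_{RX}=\mu_X\circ F(i_X)$ and whose action $R_{X,Y}\colon[X,Y]_T\to[RX,RY]^F$ is the restriction of $F_{X,Y}$ along $i_X$ and $i_Y$: as morphisms $[X,Y]_T\to[RX,FY]$, $R_{X,Y}$ followed by the inclusion into $[RX,RY]$ and $[RX,i_Y]$ equals the inclusion into $[X,Y]$ followed by $F_{X,Y}$ and $[i_X,FY]$. 2. Suppose moreover that $\mathcal{C}$ is cocomplete and biclosed, i.e. each functor $-\otimes A$ also has a right adjoint. Then there is a $\mathcal{C}$-enriched functor $L\colon\mathcal{C}^F\to\mathcal{C}_T$ which sends $Y$ to the coequaliser $\pi_Y\colon TY\to LY$ of $$\delta_Y=T\theta_Y\colon TFY\to TY\quad\text{and}\quad\beta_Y\colon TFY\xrightarrow{\Delta_{FY}}TTFY\xrightarrow{T\epsilon_Y}TY,$$ whose structure morphism satisfies $\rho_{LY}\circ\pi_Y=T(\pi_Y)\circ\Delta_Y$ and whose action $L_{X,Y}\colon[X,Y]^F\to[LX,LY]_T$ is induced by $T_{X,Y}$ along $\pi_X$ and $\pi_Y$: as morphisms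 $[X,Y]^F\to[TX,LY]$, $L_{X,Y}$ followed by the inclusion into $[LX,LY]$ and $[\pi_X,LY]$ equals the inclusion into $[X,Y]$ followed by $T_{X,Y}$ and $[TX,\pi_Y]$. The functors $L$ and $R$ form a $\mathcal{C}$-enriched adjunction $L\dashv R$: there is an isomorphism $[LX,Y]_T\cong[X,RY]^F$ which is $\mathcal{C}$-natural in $X\in\mathcal{C}^F$ and $Y\in\mathcal{C}_T$. -/

import Mathlib

open CategoryTheory CategoryTheory.Limits MonoidalCategory Opposite

universe v u w₁ w₂

noncomputable section

namespace CoContra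

/-! ### Enriched adjunctions

Mathlib's convention for enriched categories is used throughout: composition is a morphism
`Hom X Y ⊗ Hom Y Z ⟶ Hom X Z`, and, correspondingly, the internal hom `(ihom A).obj -` of a closed
monoidal category is right adjoint to `A ⊗ -`. -/

/-- A `V`-enriched adjunction `L ⊣ R`: a `V`-natural isomorphism of bifunctors
`Hom (L a) b ≅ Hom a (R b)`. As `V` is not assumed to be symmetric, `V`-naturality is
expressed separately in each variable, as compatibility with enriched composition. -/
structure EnrichedAdjunction (V : Type u) [Category.{v} V] [MonoidalCategory V]
    {A : Type w₁} [EnrichedCategory V A] {B : Type w₂} [EnrichedCategory V B]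
    (L : EnrichedFunctor V A B) (R : EnrichedFunctor V B A) where
  homIso (a : A) (b : B) :
    (EnrichedCategory.Hom (L.obj a) b : V) ≅ EnrichedCategory.Hom a (R.obj b)
  natural_left (a' a : A) (b : B) :
    (L.map a' a ▷ _) ≫ eComp V (L.obj a') (L.obj a) b ≫ (homIso a' b).hom =
      (_ ◁ (homIso a b).hom) ≫ eComp V a' a (R.obj b)
  natural_right (a : A) (b b' : B) :
    eComp V (L.obj a) b b' ≫ (homIso a b').hom =
      ((homIso a b).hom ⊗ₘ R.map b b') ≫ eComp V a (R.obj b) (R.obj b')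

variable {C : Type u} [Category.{v} C] [MonoidalCategory C] [MonoidalClosed C]

/-! ### Helper facts on internal composition -/

/-- The internal hom object. -/
abbrev hom (X Y : C) : C := (ihom X).obj Y

/-- Internal postcomposition `[X, g]`. -/
abbrev post (X : C) {Y Y' : C} (g : Y ⟶ Y') : hom X Y ⟶ hom X Y' := (ihom X).map g

/-- Internal precomposition `[f, Y]`. -/
abbrev prec {X X' : C} (f : X' ⟶ X) (Y : C) : hom X Y ⟶ hom X' Y := (MonoidalClosed.pre f).app Y

/-- Internal composition `[X, Y] ⊗ [Y, Z] ⟶ [X, Z]`. -/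
abbrev icomp (X Y Z : C) : hom X Y ⊗ hom Y Z ⟶ hom X Z := MonoidalClosed.comp X Y Z

/-- Internal identity `𝟙_ C ⟶ [X, X]`. -/
abbrev iid (X : C) : 𝟙_ C ⟶ hom X X := MonoidalClosed.id X

/-- The evaluation `X ⊗ [X, Y] ⟶ Y`. -/
abbrev iev (X Y : C) : X ⊗ hom X Y ⟶ Y := (ihom.ev X).app Y

theorem uncurry_icomp (X Y Z : C) :
    MonoidalClosed.uncurry (icomp X Y Z) =
      (α_ X (hom X Y) (hom Y Z)).inv ≫ iev X Y ▷ hom Y Z ≫ iev Y Z :=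
  MonoidalClosed.uncurry_curry _

theorem iev_post (X : C) {Y Y' : C} (g : Y ⟶ Y') :
    X ◁ post X g ≫ iev X Y' = iev X Y ≫ g :=
  ihom.ev_naturality X g

theorem iev_prec {X X' : C} (f : X' ⟶ X) (Y : C) :
    X' ◁ prec f Y ≫ iev X' Y = f ▷ hom X Y ≫ iev X Y :=
  MonoidalClosed.id_tensor_pre_app_comp_ev f Y

theorem icomp_post (X Y : C) {Z Z' : C} (g : Z ⟶ Z') :
    icomp X Y Z ≫ post X g = (hom X Y ◁ post Y g) ≫ icomp X Y Z' := by
  apply MonoidalClosed.uncurry_injective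
  rw [MonoidalClosed.uncurry_natural_right, MonoidalClosed.uncurry_natural_left,
    uncurry_icomp, uncurry_icomp, associator_inv_naturality_right_assoc,
    whisker_exchange_assoc, iev_post, Category.assoc, Category.assoc]

theorem icomp_prec {X X' : C} (f : X' ⟶ X) (Y Z : C) :
    icomp X Y Z ≫ prec f Z = (prec f Y ▷ hom Y Z) ≫ icomp X' Y Z := by
  apply MonoidalClosed.uncurry_injective
  rw [MonoidalClosed.uncurry_pre_app, MonoidalClosed.uncurry_natural_left,
    uncurry_icomp, uncurry_icomp, associator_inv_naturality_middle_assoc,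
    associator_inv_naturality_left_assoc, ← comp_whiskerRight_assoc,
    ← comp_whiskerRight_assoc, iev_prec]

theorem icomp_mid (X : C) {Y Y' : C} (g : Y ⟶ Y') (Z : C) :
    (post X g ▷ hom Y' Z) ≫ icomp X Y' Z = (hom X Y ◁ prec g Z) ≫ icomp X Y Z := by
  apply MonoidalClosed.uncurry_injective
  rw [MonoidalClosed.uncurry_natural_left, MonoidalClosed.uncurry_natural_left,
    uncurry_icomp, uncurry_icomp, associator_inv_naturality_middle_assoc,
    associator_inv_naturality_right_assoc, ← comp_whiskerRight_assoc, iev_post,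
    whisker_exchange_assoc, iev_prec, comp_whiskerRight_assoc]

theorem curry'_prec {X X' Y : C} (f : X' ⟶ X) (g : X ⟶ Y) :
    MonoidalClosed.curry' g ≫ prec f Y = MonoidalClosed.curry' (f ≫ g) := by
  simp [MonoidalClosed.curry', MonoidalClosed.curry_pre_app]

theorem iid_post {X Y : C} (g : X ⟶ Y) : iid X ≫ post X g = MonoidalClosed.curry' g := by
  rw [iid, ← MonoidalClosed.curry'_id, MonoidalClosed.curry'_ihom_map, Category.id_comp]

theorem iid_prec {X Y : C} (g : X ⟶ Y) : iid Y ≫ prec g Y = MonoidalClosed.curry' g := by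
  rw [iid, ← MonoidalClosed.curry'_id, curry'_prec, Category.comp_id]

/-! ### Internally adjoint pairs -/

/-- A natural equivalence `[T -, -] ≅ [-, F -]` of bifunctors `Cᵒᵖ × C ⥤ C`. -/
abbrev InternalHomIso (T F : C ⥤ C) :=
  T.op ⋙ MonoidalClosed.internalHom ≅
    MonoidalClosed.internalHom ⋙ (Functor.whiskeringLeft C C C).obj F

namespace InternalHomIso

variable {T F : C ⥤ C} (κ : InternalHomIso T F)

/-- The component `[T X, Y] ≅ [X, F Y]`. -/
def at' (X Y : C) : hom (T.obj X) Y ≅ hom X (F.obj Y) := (κ.app (op X)).app Y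

theorem at'_post (X : C) {Y Y' : C} (g : Y ⟶ Y') :
    (κ.at' X Y).hom ≫ post X (F.map g) = post (T.obj X) g ≫ (κ.at' X Y').hom :=
  ((κ.hom.app (op X)).naturality g).symm

theorem at'_prec {X X' : C} (f : X' ⟶ X) (Y : C) :
    (κ.at' X Y).hom ≫ prec f (F.obj Y) = prec (T.map f) Y ≫ (κ.at' X' Y).hom :=
  (congrArg (fun t => t.app Y) (κ.hom.naturality f.op)).symm

/-- The underlying external adjunction, obtained by applying global sections. -/
def external : T ⊣ F :=
  Adjunction.mkOfHomEquiv
    { homEquiv := fun X Y =>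
        { toFun := fun f =>
            MonoidalClosed.uncurry' (MonoidalClosed.curry' f ≫ (κ.at' X Y).hom)
          invFun := fun g =>
            MonoidalClosed.uncurry' (MonoidalClosed.curry' g ≫ (κ.at' X Y).inv)
          left_inv := fun f => by simp
          right_inv := fun g => by simp }
      homEquiv_naturality_left_symm := fun {X' X Y} f g => by
        apply MonoidalClosed.curry'_injective
        simp only [Equiv.coe_fn_symm_mk, MonoidalClosed.curry'_uncurry', ← curry'_prec,
          Category.assoc]
        congr 1
        rw [Iso.comp_inv_eq, Category.assoc, ← at'_prec, Iso.inv_hom_id_assoc]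
      homEquiv_naturality_right := fun {X Y Y'} f g => by
        apply MonoidalClosed.curry'_injective
        simp only [Equiv.coe_fn_mk, MonoidalClosed.curry'_uncurry',
          ← MonoidalClosed.curry'_ihom_map, Category.assoc]
        rw [at'_post] }

/-- The unit `ι : X ⟶ F T X` of the external adjunction. -/
def unit (X : C) : X ⟶ F.obj (T.obj X) := κ.external.unit.app X

/-- The counit `ε : T F Y ⟶ Y` of the external adjunction. -/
def counit (Y : C) : T.obj (F.obj Y) ⟶ Y := κ.external.counit.app Y

theorem curry'_unit (X : C) :
    MonoidalClosed.curry' (κ.unit X) =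
      MonoidalClosed.curry' (𝟙 (T.obj X)) ≫ (κ.at' X (T.obj X)).hom := by
  simp [unit, external, Adjunction.mkOfHomEquiv]

theorem curry'_counit (Y : C) :
    MonoidalClosed.curry' (κ.counit Y) ≫ (κ.at' (F.obj Y) Y).hom =
      MonoidalClosed.curry' (𝟙 (F.obj Y)) := by
  simp [counit, external, Adjunction.mkOfHomEquiv]

/-- The action of `T` on internal homs: `[X, Y] ⟶ [X, F T Y] ≅ [T X, T Y]`. -/
def mapT (X Y : C) : hom X Y ⟶ hom (T.obj X) (T.obj Y) :=
  post X (κ.unit Y) ≫ (κ.at' X (T.obj Y)).inv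

/-- The action of `F` on internal homs: `[X, Y] ⟶ [T F X, Y] ≅ [F X, F Y]`. -/
def mapF (X Y : C) : hom X Y ⟶ hom (F.obj X) (F.obj Y) :=
  prec (κ.counit X) Y ≫ (κ.at' (F.obj X) Y).hom

end InternalHomIso

/-- An internally adjoint pair `T ⊣ F` of endofunctors of a closed monoidal category: an
equivalence `[T -, -] ≅ [-, F -]` of bifunctors which is `C`-natural in both variables, with
respect to the actions `[X, Y] ⟶ [T X, T Y]` and `[X, Y] ⟶ [F X, F Y]` that it induces. -/
structure InternalAdjunction (T F : C ⥤ C) where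
  homIso : InternalHomIso T F
  natural_left (X' X Y : C) :
    (homIso.mapT X' X ▷ hom (T.obj X) Y) ≫ icomp (T.obj X') (T.obj X) Y ≫ (homIso.at' X' Y).hom =
      (hom X' X ◁ (homIso.at' X Y).hom) ≫ icomp X' X (F.obj Y)
  natural_right (X Y Y' : C) :
    icomp (T.obj X) Y Y' ≫ (homIso.at' X Y').hom =
      ((homIso.at' X Y).hom ⊗ₘ homIso.mapF Y Y') ≫ icomp X (F.obj Y) (F.obj Y')

namespace InternalAdjunction

variable {T F : C ⥤ C} (J : InternalAdjunction T F)

/-- The component `[T X, Y] ≅ [X, F Y]`. -/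
abbrev iso (X Y : C) : hom (T.obj X) Y ≅ hom X (F.obj Y) := J.homIso.at' X Y

/-- The external adjunction. -/
abbrev external : T ⊣ F := J.homIso.external

/-- The action of `T` on internal homs. -/
abbrev mapT (X Y : C) : hom X Y ⟶ hom (T.obj X) (T.obj Y) := J.homIso.mapT X Y

/-- The action of `F` on internal homs. -/
abbrev mapF (X Y : C) : hom X Y ⟶ hom (F.obj X) (F.obj Y) := J.homIso.mapF X Y

theorem mapT_comp (X Y Z : C) :
    icomp X Y Z ≫ J.mapT X Z =
      (J.mapT X Y ⊗ₘ J.mapT Y Z) ≫ icomp (T.obj X) (T.obj Y) (T.obj Z) := by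
  rw [← cancel_mono (J.iso X (T.obj Z)).hom, Category.assoc, Category.assoc]
  have e : ∀ A B : C, J.mapT A B ≫ (J.iso A (T.obj B)).hom =
      post A (J.homIso.unit B) := fun A B => by
    simp [mapT, InternalHomIso.mapT]
  rw [e, icomp_post, ← e, tensorHom_def', Category.assoc, J.natural_left,
    ← whiskerLeft_comp_assoc]

theorem mapF_comp (X Y Z : C) :
    icomp X Y Z ≫ J.mapF X Z =
      (J.mapF X Y ⊗ₘ J.mapF Y Z) ≫ icomp (F.obj X) (F.obj Y) (F.obj Z) := by
  simp only [mapF, InternalHomIso.mapF]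
  rw [← Category.assoc, icomp_prec, Category.assoc, J.natural_right,
    whiskerRight_comp_tensorHom_assoc]
  rfl

theorem mapT_id (X : C) : iid X ≫ J.mapT X X = iid (T.obj X) := by
  rw [mapT, InternalHomIso.mapT, ← Category.assoc, iid_post, Iso.comp_inv_eq,
    InternalHomIso.curry'_unit, MonoidalClosed.curry'_id]

theorem mapF_id (X : C) : iid X ≫ J.mapF X X = iid (F.obj X) := by
  rw [mapF, InternalHomIso.mapF, ← Category.assoc, iid_prec,
    InternalHomIso.curry'_counit, MonoidalClosed.curry'_id]

end InternalAdjunction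

variable (C) in
/-- An internally adjoint comonad-monad pair `T ⊣ F` on a closed monoidal category `C`: the
comultiplication and the counit of `T` are `C`-natural, and the monad structure of `F`
is the one which corresponds to the comonad structure of `T` under the adjunction. -/
structure ComonadMonadPair where
  T : Comonad C
  F : Monad C
  adj : InternalAdjunction T.toFunctor F.toFunctor
  δ_natural (X Y : C) :
    adj.mapT X Y ≫ post (T.obj X) (T.δ.app Y) =
      adj.mapT X Y ≫ adj.mapT (T.obj X) (T.obj Y) ≫ prec (T.δ.app X) (T.obj (T.obj Y))
  ε_natural (X Y : C) :
    adj.mapT X Y ≫ post (T.obj X) (T.ε.app Y) = prec (T.ε.app X) Y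
  μ_eq : F.μ = conjugateEquiv (adj.external.comp adj.external) adj.external T.δ
  η_eq : F.η = conjugateEquiv Adjunction.id adj.external T.ε

namespace ComonadMonadPair

variable (P : ComonadMonadPair C)

/-- `T`-comodules. -/
def Comodule : Type max u v := P.T.Coalgebra

/-- `F`-contramodules, that is, modules over the monad `F`. -/
def Contramodule : Type max u v := P.F.Algebra

namespace Comodule

variable {P}

/-- The underlying object of a comodule. -/
def obj (X : P.Comodule) : C := Comonad.Coalgebra.A X

/-- The structure morphism `X ⟶ T X` of a comodule. -/
def ρ (X : P.Comodule) : X.obj ⟶ P.T.obj X.obj := Comonad.Coalgebra.a X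

end Comodule

namespace Contramodule

variable {P}

/-- The underlying object of a contramodule. -/
def obj (Y : P.Contramodule) : C := Monad.Algebra.A Y

/-- The structure morphism `F Y ⟶ Y` of a contramodule. -/
def θ (Y : P.Contramodule) : P.F.obj Y.obj ⟶ Y.obj := Monad.Algebra.a Y

end Contramodule

/-- `φ`: internal postcomposition with the structure morphism of `Y`. -/
def φT (X Y : P.Comodule) : hom X.obj Y.obj ⟶ hom X.obj (P.T.obj Y.obj) :=
  post X.obj Y.ρ

/-- `ψ`: `[X, Y] ⟶ [X, F T Y] ≅ [T X, T Y] ⟶ [X, T Y]`. -/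
def ψT (X Y : P.Comodule) : hom X.obj Y.obj ⟶ hom X.obj (P.T.obj Y.obj) :=
  post X.obj (P.adj.homIso.unit Y.obj) ≫ (P.adj.iso X.obj (P.T.obj Y.obj)).inv ≫
    prec X.ρ (P.T.obj Y.obj)

theorem ψT_eq (X Y : P.Comodule) :
    P.ψT X Y = P.adj.mapT X.obj Y.obj ≫ prec X.ρ (P.T.obj Y.obj) := by
  simp [ψT, InternalAdjunction.mapT, InternalHomIso.mapT]

/-- `φ`: `[X, Y] ⟶ [T F X, Y] ≅ [F X, F Y] ⟶ [F X, Y]`. -/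
def φF (X Y : P.Contramodule) : hom X.obj Y.obj ⟶ hom (P.F.obj X.obj) Y.obj :=
  prec (P.adj.homIso.counit X.obj) Y.obj ≫ (P.adj.iso (P.F.obj X.obj) Y.obj).hom ≫
    post (P.F.obj X.obj) Y.θ

/-- `ψ`: internal precomposition with the structure morphism of `X`. -/
def ψF (X Y : P.Contramodule) : hom X.obj Y.obj ⟶ hom (P.F.obj X.obj) Y.obj :=
  prec X.θ Y.obj

theorem φF_eq (X Y : P.Contramodule) :
    P.φF X Y = P.adj.mapF X.obj Y.obj ≫ post (P.F.obj X.obj) Y.θ := by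
  simp [φF, InternalAdjunction.mapF, InternalHomIso.mapF]

/-- The chief `T 𝟙`, as a comodule with the structure morphism `T 𝟙 ⟶ T T 𝟙`. -/
def chief : P.Comodule := P.T.cofree.obj (𝟙_ C)

/-- `δ : T F Y ⟶ T Y`, induced by the structure morphism of `Y`. -/
def δL (Y : P.Contramodule) : P.T.obj (P.F.obj Y.obj) ⟶ P.T.obj Y.obj := P.T.map Y.θ

/-- `β : T F Y ⟶ T T F Y ⟶ T Y`, induced by the comultiplication of `T` and by the
counit of the external adjunction. -/
def βL (Y : P.Contramodule) : P.T.obj (P.F.obj Y.obj) ⟶ P.T.obj Y.obj :=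
  P.T.δ.app (P.F.obj Y.obj) ≫ P.T.map (P.adj.homIso.counit Y.obj)

variable [HasEqualizers C]

/-! ### The enriched category of comodules -/

/-- The comodule maps object `[X, Y]_T`. -/
def homT (X Y : P.Comodule) : C := equalizer (P.φT X Y) (P.ψT X Y)

/-- The inclusion `[X, Y]_T ⟶ [X, Y]`. -/
def γT (X Y : P.Comodule) : P.homT X Y ⟶ hom X.obj Y.obj := equalizer.ι _ _

instance (X Y : P.Comodule) : Mono (P.γT X Y) := inferInstanceAs (Mono (equalizer.ι _ _))

theorem γT_condition (X Y : P.Comodule) :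
    P.γT X Y ≫ post X.obj Y.ρ =
      P.γT X Y ≫ P.adj.mapT X.obj Y.obj ≫ prec X.ρ (P.T.obj Y.obj) := by
  rw [← ψT_eq]; exact equalizer.condition _ _

/-- The lift to `[X, Y]_T` of a morphism into `[X, Y]`. -/
def liftT {W : C} {X Y : P.Comodule} (k : W ⟶ hom X.obj Y.obj)
    (h : k ≫ post X.obj Y.ρ = k ≫ P.adj.mapT X.obj Y.obj ≫ prec X.ρ (P.T.obj Y.obj)) :
    W ⟶ P.homT X Y :=
  equalizer.lift k (by rw [ψT_eq]; exact h)

@[simp]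
theorem liftT_γT {W : C} {X Y : P.Comodule} (k : W ⟶ hom X.obj Y.obj) (h) :
    P.liftT k h ≫ P.γT X Y = k := equalizer.lift_ι _ _

/-- The identity of the enriched category of comodules. -/
def idT (X : P.Comodule) : 𝟙_ C ⟶ P.homT X X :=
  P.liftT (iid X.obj) (by
    rw [iid_post, ← Category.assoc, P.adj.mapT_id]
    exact (iid_prec X.ρ).symm)

/-- The composition of the enriched category of comodules. -/
def compT (X Y Z : P.Comodule) : P.homT X Y ⊗ P.homT Y Z ⟶ P.homT X Z :=
  P.liftT ((P.γT X Y ⊗ₘ P.γT Y Z) ≫ icomp X.obj Y.obj Z.obj) (by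
    simp only [Category.assoc]
    rw [icomp_post, ← Category.assoc (icomp X.obj Y.obj Z.obj), P.adj.mapT_comp, Category.assoc,
      icomp_prec, tensorHom_comp_whiskerLeft_assoc, P.γT_condition,
      ← Category.assoc (P.γT Y Z), ← tensorHom_comp_whiskerLeft_assoc, ← icomp_mid,
      tensorHom_comp_whiskerRight_assoc, P.γT_condition, ← Category.assoc (P.γT X Y),
      ← tensorHom_comp_whiskerRight_assoc, tensorHom_comp_tensorHom_assoc])

@[simp]
theorem idT_γT (X : P.Comodule) : P.idT X ≫ P.γT X X = iid X.obj := P.liftT_γT _ _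

@[simp]
theorem compT_γT (X Y Z : P.Comodule) :
    P.compT X Y Z ≫ P.γT X Z = (P.γT X Y ⊗ₘ P.γT Y Z) ≫ icomp X.obj Y.obj Z.obj :=
  P.liftT_γT _ _

instance : EnrichedCategory C P.Comodule where
  Hom := P.homT
  id := P.idT
  comp := P.compT
  id_comp X Y := by
    rw [← cancel_mono (P.γT X Y)]
    simp only [Category.assoc, compT_γT, Category.id_comp]
    rw [whiskerRight_comp_tensorHom_assoc, idT_γT, tensorHom_def', Category.assoc,
      ← leftUnitor_inv_naturality_assoc, MonoidalClosed.id_comp, Category.comp_id]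
  comp_id X Y := by
    rw [← cancel_mono (P.γT X Y)]
    simp only [Category.assoc, compT_γT, Category.id_comp]
    rw [whiskerLeft_comp_tensorHom_assoc, idT_γT, MonoidalCategory.tensorHom_def, Category.assoc,
      ← rightUnitor_inv_naturality_assoc, MonoidalClosed.comp_id, Category.comp_id]
  assoc W X Y Z := by
    rw [← cancel_mono (P.γT W Z)]
    simp only [Category.assoc, compT_γT]
    rw [whiskerRight_comp_tensorHom_assoc, compT_γT, whiskerLeft_comp_tensorHom_assoc, compT_γT,
      ← tensorHom_comp_whiskerRight_assoc, ← tensorHom_comp_whiskerLeft_assoc,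
      ← MonoidalClosed.assoc, ← associator_inv_naturality_assoc]

/-! ### The enriched category of contramodules -/

/-- The contramodule maps object `[X, Y]^F`. -/
def homF (X Y : P.Contramodule) : C := equalizer (P.φF X Y) (P.ψF X Y)

/-- The inclusion `[X, Y]^F ⟶ [X, Y]`. -/
def γF (X Y : P.Contramodule) : P.homF X Y ⟶ hom X.obj Y.obj := equalizer.ι _ _

instance (X Y : P.Contramodule) : Mono (P.γF X Y) := inferInstanceAs (Mono (equalizer.ι _ _))

theorem γF_condition (X Y : P.Contramodule) :
    P.γF X Y ≫ prec X.θ Y.obj =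
      P.γF X Y ≫ P.adj.mapF X.obj Y.obj ≫ post (P.F.obj X.obj) Y.θ := by
  rw [← φF_eq]; exact (equalizer.condition _ _).symm

/-- The lift to `[X, Y]^F` of a morphism into `[X, Y]`. -/
def liftF {W : C} {X Y : P.Contramodule} (k : W ⟶ hom X.obj Y.obj)
    (h : k ≫ prec X.θ Y.obj = k ≫ P.adj.mapF X.obj Y.obj ≫ post (P.F.obj X.obj) Y.θ) :
    W ⟶ P.homF X Y :=
  equalizer.lift k (by rw [φF_eq]; exact h.symm)

@[simp]
theorem liftF_γF {W : C} {X Y : P.Contramodule} (k : W ⟶ hom X.obj Y.obj) (h) :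
    P.liftF k h ≫ P.γF X Y = k := equalizer.lift_ι _ _

/-- The identity of the enriched category of contramodules. -/
def idF (X : P.Contramodule) : 𝟙_ C ⟶ P.homF X X :=
  P.liftF (iid X.obj) (by
    rw [iid_prec, ← Category.assoc, P.adj.mapF_id]
    exact (iid_post X.θ).symm)

/-- The composition of the enriched category of contramodules. -/
def compF (X Y Z : P.Contramodule) : P.homF X Y ⊗ P.homF Y Z ⟶ P.homF X Z :=
  P.liftF ((P.γF X Y ⊗ₘ P.γF Y Z) ≫ icomp X.obj Y.obj Z.obj) (by
    simp only [Category.assoc]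
    rw [icomp_prec, ← Category.assoc (icomp X.obj Y.obj Z.obj), P.adj.mapF_comp, Category.assoc,
      icomp_post, tensorHom_comp_whiskerRight_assoc, P.γF_condition,
      ← Category.assoc (P.γF X Y), ← tensorHom_comp_whiskerRight_assoc, icomp_mid,
      tensorHom_comp_whiskerLeft_assoc, P.γF_condition, ← Category.assoc (P.γF Y Z),
      ← tensorHom_comp_whiskerLeft_assoc, tensorHom_comp_tensorHom_assoc])

@[simp]
theorem idF_γF (X : P.Contramodule) : P.idF X ≫ P.γF X X = iid X.obj := P.liftF_γF _ _

@[simp]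
theorem compF_γF (X Y Z : P.Contramodule) :
    P.compF X Y Z ≫ P.γF X Z = (P.γF X Y ⊗ₘ P.γF Y Z) ≫ icomp X.obj Y.obj Z.obj :=
  P.liftF_γF _ _

instance : EnrichedCategory C P.Contramodule where
  Hom := P.homF
  id := P.idF
  comp := P.compF
  id_comp X Y := by
    rw [← cancel_mono (P.γF X Y)]
    simp only [Category.assoc, compF_γF, Category.id_comp]
    rw [whiskerRight_comp_tensorHom_assoc, idF_γF, tensorHom_def', Category.assoc,
      ← leftUnitor_inv_naturality_assoc, MonoidalClosed.id_comp, Category.comp_id]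
  comp_id X Y := by
    rw [← cancel_mono (P.γF X Y)]
    simp only [Category.assoc, compF_γF, Category.id_comp]
    rw [whiskerLeft_comp_tensorHom_assoc, idF_γF, MonoidalCategory.tensorHom_def, Category.assoc,
      ← rightUnitor_inv_naturality_assoc, MonoidalClosed.comp_id, Category.comp_id]
  assoc W X Y Z := by
    rw [← cancel_mono (P.γF W Z)]
    simp only [Category.assoc, compF_γF]
    rw [whiskerRight_comp_tensorHom_assoc, compF_γF, whiskerLeft_comp_tensorHom_assoc, compF_γF,
      ← tensorHom_comp_whiskerRight_assoc, ← tensorHom_comp_whiskerLeft_assoc,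
      ← MonoidalClosed.assoc, ← associator_inv_naturality_assoc]

/-! ### The functors `R` and `L` -/

/-- The inclusion of `[T 𝟙, X]_T` into `[T 𝟙, X] ≅ [𝟙, F X] ≅ F X`. -/
def inclR (X : P.Comodule) : P.homT P.chief X ⟶ P.F.obj X.obj :=
  P.γT P.chief X ≫ (P.adj.iso (𝟙_ C) X.obj).hom ≫
    (MonoidalClosed.unitIsoSelf (P.F.obj X.obj)).hom

/-- The enriched functor `R` is `X ↦ [T 𝟙, X]_T`: the `F`-module structure of `R X` is the
restriction of the one of `F X`, and the action of `R` on hom objects is the restriction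
of `[X, Y] ⟶ [F X, F Y]`. -/
structure IsComoduleHom (R : EnrichedFunctor C P.Comodule P.Contramodule) : Prop where
  obj_eq (X : P.Comodule) : (R.obj X).obj = P.homT P.chief X
  θ_eq (X : P.Comodule) :
    (R.obj X).θ ≫ eqToHom (obj_eq X) ≫ P.inclR X =
      P.F.map (eqToHom (obj_eq X) ≫ P.inclR X) ≫ P.F.μ.app X.obj
  map_eq (X Y : P.Comodule) :
    R.map X Y ≫ P.γF (R.obj X) (R.obj Y) ≫
        post (R.obj X).obj (eqToHom (obj_eq Y) ≫ P.inclR Y) =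
      P.γT X Y ≫ P.adj.mapF X.obj Y.obj ≫
        prec (eqToHom (obj_eq X) ≫ P.inclR X) (P.F.obj Y.obj)

/-- The enriched functor `L` sends `Y` to the coequaliser of `T F Y ⇉ T Y`: the `T`-comodule
structure of `L Y` is induced by the one of `T Y`, and the action of `L` on hom objects is
induced by `[X, Y] ⟶ [T X, T Y]`. -/
structure IsContratensor [HasCoequalizers C]
    (L : EnrichedFunctor C P.Contramodule P.Comodule) : Prop where
  obj_eq (Y : P.Contramodule) : coequalizer (P.δL Y) (P.βL Y) = (L.obj Y).obj
  ρ_eq (Y : P.Contramodule) :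
    (coequalizer.π (P.δL Y) (P.βL Y) ≫ eqToHom (obj_eq Y)) ≫ (L.obj Y).ρ =
      P.T.δ.app Y.obj ≫ P.T.map (coequalizer.π (P.δL Y) (P.βL Y) ≫ eqToHom (obj_eq Y))
  map_eq (X Y : P.Contramodule) :
    L.map X Y ≫ P.γT (L.obj X) (L.obj Y) ≫
        prec (coequalizer.π (P.δL X) (P.βL X) ≫ eqToHom (obj_eq X)) (L.obj Y).obj =
      P.γF X Y ≫ P.adj.mapT X.obj Y.obj ≫
        post (P.T.obj X.obj) (coequalizer.π (P.δL Y) (P.βL Y) ≫ eqToHom (obj_eq Y))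

end ComonadMonadPair

end CoContra

end

noncomputable section

namespace CoContra

variable {C : Type u} [Category.{v} C] [MonoidalCategory C] [MonoidalClosed C]

/-! ### Internal homs -/

/-! The theorem becomes a comparison of two subobjects that `κ` identifies. Along `π_X` the object
`[LX, Y]_T` embeds in `[TX, Y]`, and along `i_Y` the object `[X, RY]^F` embeds in `[X, FY]`. A
morphism `k` into `[TX, Y]` lifts to the first exactly when (a) it equalises precomposition with
`δ_X` and `β_X`, and (b) it satisfies the comodule equation for the coaction `Δ_X` on `TX`
(`exists_homT_objL`). A morphism into `[X, FY]` lifts to the second exactly when (a') it satisfies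
the module equation for `μ_Y` on `FY`, and (b') it equalises postcomposition with `Fρ_Y` and
`coactF` (`exists_homF_objR`). Here `RY` is read as the equaliser of these two morphisms `FY ⟶ FTY`,
dually to the coequaliser `LX`.

Under `κ`, condition (a) matches (a') by `prec_δ_counit_iso`, and (b) matches (b') by
`mapT_prec_δ_iso`. Both rest on `iso_iso_post_μ`: internally, not only on global sections, `μ` is
the mate of `Δ`. This follows from the enriched Yoneda lemma, `C`-naturality of `κ` in the first
variable and `C`-naturality of `Δ`.

The actions on hom objects come from the same two lifting lemmas, using `C`-naturality of `μ`,
`coactF`, `Δ` and `β`. As the embeddings are monic, functoriality and naturality of the adjunction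
reduce to the corresponding facts about `F`, `T` and `κ`. -/

theorem prec_comp {X Y Z : C} (f : X ⟶ Y) (g : Y ⟶ Z) (W : C) :
    prec (f ≫ g) W = prec g W ≫ prec f W := by
  simp [prec, MonoidalClosed.pre_map]

theorem post_comp (W : C) {X Y Z : C} (f : X ⟶ Y) (g : Y ⟶ Z) :
    post W (f ≫ g) = post W f ≫ post W g :=
  (ihom W).map_comp f g

theorem prec_post {X X' : C} (f : X' ⟶ X) {Y Y' : C} (g : Y ⟶ Y') :
    prec f Y ≫ post X' g = post X g ≫ prec f Y' :=
  ((MonoidalClosed.pre f).naturality g).symm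

/-- The enriched Yoneda lemma: a `C`-natural transformation `[-, A] ⟶ [-, B]` is determined by
its value at the identity of `A`. -/
theorem eq_post_of_natural {A B : C} (a : ∀ X : C, hom X A ⟶ hom X B)
    (ha : ∀ X : C, icomp X A A ≫ a X = (hom X A ◁ a A) ≫ icomp X A B) (g : A ⟶ B)
    (hg : iid A ≫ a A = MonoidalClosed.curry' g) (X : C) : a X = post X g := by
  -- Inserting the identity of `A` as the right factor of the composition recovers every `b X` from
  -- `iid A ≫ b A`.
  have key : ∀ b : ∀ X : C, hom X A ⟶ hom X B,
      (∀ X : C, icomp X A A ≫ b X = (hom X A ◁ b A) ≫ icomp X A B) →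
      b X = (ρ_ (hom X A)).inv ≫ (hom X A ◁ (iid A ≫ b A)) ≫ icomp X A B := by
    intro b hb
    rw [MonoidalCategory.whiskerLeft_comp, Category.assoc, ← hb, ← Category.assoc (_ ◁ iid A),
      ← Category.assoc, MonoidalClosed.comp_id, Category.id_comp]
  rw [key a ha, key (fun X => post X g) (fun X => icomp_post X A g), hg, iid_post]

/-! ### Transposition along `κ`, and `C`-naturality of its unit and counit -/

namespace InternalHomIso

variable {T F : C ⥤ C} (κ : InternalHomIso T F)

theorem at'_inv_post (X : C) {Y Y' : C} (g : Y ⟶ Y') :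
    (κ.at' X Y).inv ≫ post (T.obj X) g = post X (F.map g) ≫ (κ.at' X Y').inv := by
  rw [Iso.inv_comp_eq, ← Category.assoc, at'_post, Category.assoc, Iso.hom_inv_id,
    Category.comp_id]

theorem at'_inv_prec {X X' : C} (f : X' ⟶ X) (Y : C) :
    (κ.at' X Y).inv ≫ prec (T.map f) Y = prec f (F.obj Y) ≫ (κ.at' X' Y).inv := by
  rw [Iso.inv_comp_eq, ← Category.assoc, at'_prec, Category.assoc, Iso.hom_inv_id,
    Category.comp_id]

/-- On global sections `κ` is the usual transposition. This and the inverse formula below serve to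
evaluate composites of `κ` at identities. -/
theorem curry'_at' {X Y : C} (f : T.obj X ⟶ Y) :
    MonoidalClosed.curry' f ≫ (κ.at' X Y).hom =
      MonoidalClosed.curry' (κ.unit X ≫ F.map f) := by
  rw [← MonoidalClosed.curry'_ihom_map, curry'_unit, Category.assoc, at'_post,
    ← Category.assoc, MonoidalClosed.curry'_ihom_map, Category.id_comp]

theorem curry'_at'_inv {X Y : C} (g : X ⟶ F.obj Y) :
    MonoidalClosed.curry' g ≫ (κ.at' X Y).inv =
      MonoidalClosed.curry' (T.map g ≫ κ.counit Y) := by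
  rw [Iso.comp_inv_eq, ← curry'_prec, Category.assoc, ← at'_prec, ← Category.assoc,
    curry'_counit, curry'_prec, Category.comp_id]

theorem unit_naturality {X Y : C} (f : X ⟶ Y) :
    f ≫ κ.unit Y = κ.unit X ≫ F.map (T.map f) :=
  κ.external.unit.naturality f

theorem counit_naturality {X Y : C} (f : X ⟶ Y) :
    T.map (F.map f) ≫ κ.counit Y = κ.counit X ≫ f :=
  κ.external.counit.naturality f

theorem left_triangle (X : C) : T.map (κ.unit X) ≫ κ.counit (T.obj X) = 𝟙 (T.obj X) :=
  κ.external.left_triangle_components X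

theorem right_triangle (Y : C) : κ.unit (F.obj Y) ≫ F.map (κ.counit Y) = 𝟙 (F.obj Y) :=
  κ.external.right_triangle_components Y

theorem mapT_post (X : C) {Y Y' : C} (g : Y ⟶ Y') :
    κ.mapT X Y ≫ post (T.obj X) (T.map g) = post X g ≫ κ.mapT X Y' := by
  rw [mapT, mapT, Category.assoc, at'_inv_post, ← Category.assoc, ← Category.assoc,
    ← post_comp, ← post_comp, unit_naturality]

theorem mapT_prec {X X' : C} (f : X' ⟶ X) (Y : C) :
    κ.mapT X Y ≫ prec (T.map f) (T.obj Y) = prec f Y ≫ κ.mapT X' Y := by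
  rw [mapT, mapT, Category.assoc, at'_inv_prec, ← Category.assoc, ← Category.assoc, prec_post]

theorem mapF_post (X : C) {Y Y' : C} (g : Y ⟶ Y') :
    κ.mapF X Y ≫ post (F.obj X) (F.map g) = post X g ≫ κ.mapF X Y' := by
  rw [mapF, mapF, Category.assoc, at'_post, ← Category.assoc, ← Category.assoc, prec_post]

theorem mapF_prec {X X' : C} (f : X' ⟶ X) (Y : C) :
    κ.mapF X Y ≫ prec (F.map f) (F.obj Y) = prec f Y ≫ κ.mapF X' Y := by
  rw [mapF, mapF, Category.assoc, at'_prec, ← Category.assoc, ← Category.assoc,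
    ← prec_comp, ← prec_comp, counit_naturality]

/-- The unit of the external adjunction is `C`-natural. -/
theorem mapT_mapF_prec_unit (X Y : C) :
    κ.mapT X Y ≫ κ.mapF (T.obj X) (T.obj Y) ≫ prec (κ.unit X) (F.obj (T.obj Y)) =
      post X (κ.unit Y) := by
  rw [mapF, Category.assoc, at'_prec, ← Category.assoc (prec _ _), ← prec_comp, left_triangle,
    mapT]
  simp [prec]

/-- The counit of the external adjunction is `C`-natural. -/
theorem mapF_mapT_post_counit (X Y : C) :
    κ.mapF X Y ≫ κ.mapT (F.obj X) (F.obj Y) ≫ post (T.obj (F.obj X)) (κ.counit Y) =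
      prec (κ.counit X) Y := by
  rw [mapT, Category.assoc, at'_inv_post, ← Category.assoc (post _ _), ← post_comp,
    right_triangle, mapF]
  simp [post]

end InternalHomIso

/-! ### The multiplication of `F` as the internal mate of `Δ` -/

namespace InternalAdjunction

variable {T F : C ⥤ C} (J : InternalAdjunction T F)

theorem natural_left_inv (X' X Y : C) :
    icomp X' X (F.obj Y) ≫ (J.iso X' Y).inv =
      (hom X' X ◁ (J.iso X Y).inv) ≫ (J.mapT X' X ▷ hom (T.obj X) Y) ≫
        icomp (T.obj X') (T.obj X) Y := by
  rw [Iso.comp_inv_eq, Category.assoc, Category.assoc, J.natural_left, ← MonoidalCategory.whiskerLeft_comp_assoc, Iso.inv_hom_id,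
    MonoidalCategory.whiskerLeft_id, Category.id_comp]

end InternalAdjunction

namespace ComonadMonadPair

variable (P : ComonadMonadPair C)

/-- Unfolds the conjugate: `μ_Z` is the transpose of `TFFZ ⟶ TTFFZ ⟶ TFZ ⟶ Z`. -/
theorem μ_app (Z : C) :
    P.F.μ.app Z = P.adj.homIso.unit (P.F.obj (P.F.obj Z)) ≫
      P.F.map (P.T.δ.app (P.F.obj (P.F.obj Z)) ≫
        P.T.map (P.adj.homIso.counit (P.F.obj Z)) ≫ P.adj.homIso.counit Z) := by
  rw [P.μ_eq, conjugateEquiv_apply_app, Adjunction.comp_counit_app, ← Functor.map_comp]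
  rfl

/-- The multiplication of `F` is the internal mate of the comultiplication of `T`. -/
theorem iso_iso_post_μ (X Z : C) :
    (P.adj.iso (P.T.obj X) Z).hom ≫ (P.adj.iso X (P.F.obj Z)).hom ≫ post X (P.F.μ.app Z) =
      prec (P.T.δ.app X) Z ≫ (P.adj.iso X Z).hom := by
  -- With `[X, μ_Z]` isolated, the other side is a family `[X, FFZ] ⟶ [X, FZ]`, to which the Yoneda
  -- lemma applies.
  rw [← Iso.eq_inv_comp, ← Iso.eq_inv_comp]
  refine (eq_post_of_natural (fun X => (P.adj.iso X (P.F.obj Z)).inv ≫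
    (P.adj.iso (P.T.obj X) Z).inv ≫ prec (P.T.δ.app X) Z ≫ (P.adj.iso X Z).hom)
    (fun X => ?_) _ ?_ X).symm
  · set A := P.F.obj (P.F.obj Z)
    rw [← Category.assoc (icomp _ _ _), P.adj.natural_left_inv]
    simp only [Category.assoc]
    rw [← Category.assoc (icomp _ _ _), P.adj.natural_left_inv]
    simp only [Category.assoc]
    rw [← Category.assoc (icomp _ _ _), icomp_prec]
    simp only [Category.assoc, MonoidalCategory.whiskerLeft_comp]
    rw [← P.adj.natural_left]
    congr 1
    rw [← whisker_exchange_assoc]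
    congr 1
    -- Passing `κ⁻¹` twice through the composition has applied `T` twice to the left factor.
    -- Naturality of `Δ` reduces this to one application of `T`, and `m` then slides `Δ` over to the
    -- right factor.
    rw [← comp_whiskerRight_assoc, ← comp_whiskerRight_assoc, Category.assoc, ← P.δ_natural,
      comp_whiskerRight_assoc]
    have m : (post (P.T.obj X) (P.T.δ.app A) ▷ hom (P.T.obj (P.T.obj A)) Z) ≫
        icomp (P.T.obj X) (P.T.obj (P.T.obj A)) Z =
          (hom (P.T.obj X) (P.T.obj A) ◁ prec (P.T.δ.app A) Z) ≫
            icomp (P.T.obj X) (P.T.obj A) Z := icomp_mid _ _ _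
    rw [reassoc_of% m, ← whisker_exchange_assoc]
  -- The value at the identity of `FFZ` is an external transpose, computed to be the formula
  -- `μ_app`.
  · rw [iid, ← MonoidalClosed.curry'_id, ← Category.assoc, InternalHomIso.curry'_at'_inv,
      ← Category.assoc, InternalHomIso.curry'_at'_inv, ← Category.assoc, curry'_prec,
      InternalHomIso.curry'_at', μ_app]
    simp

/-- Under `[T X, Y] ≅ [X, F Y]`, the transposed action on `[X, F Y]`. -/
theorem prec_δ_counit_iso (X Y : C) :
    prec (P.T.δ.app (P.F.obj X) ≫ P.T.map (P.adj.homIso.counit X)) Y ≫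
        (P.adj.iso (P.F.obj X) Y).hom =
      (P.adj.iso X Y).hom ≫ P.adj.mapF X (P.F.obj Y) ≫ post (P.F.obj X) (P.F.μ.app Y) := by
  rw [prec_comp, Category.assoc, ← iso_iso_post_μ, InternalAdjunction.mapF, InternalHomIso.mapF,
    Category.assoc, ← Category.assoc (Iso.hom _) (prec _ _), InternalHomIso.at'_prec,
    Category.assoc]

/-- The transpose of `μ_app`, obtained from a triangle identity. -/
theorem counit_μ (X : C) :
    P.T.map (P.F.μ.app X) ≫ P.adj.homIso.counit X =
      P.T.δ.app (P.F.obj (P.F.obj X)) ≫ P.T.map (P.adj.homIso.counit (P.F.obj X)) ≫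
        P.adj.homIso.counit X := by
  rw [μ_app, Functor.map_comp, Category.assoc, InternalHomIso.counit_naturality,
    ← Category.assoc]
  exact (congrArg (· ≫ _) (P.adj.homIso.left_triangle _)).trans (Category.id_comp _)

/-- The multiplication of `F` is `C`-natural. -/
theorem mapF_prec_μ (X Y : C) :
    P.adj.mapF X Y ≫ prec (P.F.μ.app X) (P.F.obj Y) =
      P.adj.mapF X Y ≫ P.adj.mapF (P.F.obj X) (P.F.obj Y) ≫
        post (P.F.obj (P.F.obj X)) (P.F.μ.app Y) := by
  rw [InternalAdjunction.mapF, InternalHomIso.mapF, Category.assoc, Category.assoc,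
    ← prec_δ_counit_iso, InternalHomIso.at'_prec, ← Category.assoc, ← Category.assoc, ← prec_comp,
    ← prec_comp, counit_μ, Category.assoc]
  rfl

end ComonadMonadPair

theorem post_unitIsoSelf {X Y : C} (g : X ⟶ Y) :
    post (𝟙_ C) g ≫ (MonoidalClosed.unitIsoSelf Y).hom =
      (MonoidalClosed.unitIsoSelf X).hom ≫ g :=
  MonoidalClosed.unitNatIso.inv.naturality g

/-- Reduces lifting problems along `[A, g]` to lifting problems along `g`, with source `A ⊗ W`. -/
theorem comp_post_eq_curry {W X Y Z : C} (k : W ⟶ hom X Y) (g : Y ⟶ Z) :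
    k ≫ post X g = MonoidalClosed.curry (MonoidalClosed.uncurry k ≫ g) := by
  rw [MonoidalClosed.curry_natural_right, MonoidalClosed.curry_uncurry]

namespace ComonadMonadPair

variable (P : ComonadMonadPair C)

/-! ### The functor `R` -/

/-- The isomorphism `[T 𝟙, X] ≅ [𝟙, F X] ≅ F X`. -/
def chiefIso (X : C) : hom P.chief.obj X ≅ P.F.obj X :=
  P.adj.iso (𝟙_ C) X ≪≫ MonoidalClosed.unitIsoSelf (P.F.obj X)

theorem post_chiefIso {X Y : C} (g : X ⟶ Y) :
    post P.chief.obj g ≫ (P.chiefIso Y).hom = (P.chiefIso X).hom ≫ P.F.map g := by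
  have h : post (P.T.obj (𝟙_ C)) g ≫ (P.adj.iso (𝟙_ C) Y).hom =
    (P.adj.iso (𝟙_ C) X).hom ≫ post (𝟙_ C) (P.F.map g) := (P.adj.homIso.at'_post _ g).symm
  change post (P.T.obj (𝟙_ C)) g ≫ (P.adj.iso (𝟙_ C) Y).hom ≫ _ =
    ((P.adj.iso (𝟙_ C) X).hom ≫ _) ≫ _
  rw [reassoc_of% h, Category.assoc, ← post_unitIsoSelf]

/-- The morphism `F X ⟶ F T X` which, for a comodule `X`, agrees with `F ρ` on `[T 𝟙, X]_T`. -/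
def coactF (X : C) : P.F.obj X ⟶ P.F.obj (P.T.obj X) :=
  P.F.map (P.adj.homIso.unit X) ≫ P.F.μ.app (P.T.obj X)

/-- Under `[T X, Y] ≅ [X, F Y]`, the transposed coaction on `[T X, Y]`. -/
theorem mapT_prec_δ_iso (X Y : C) :
    P.adj.mapT (P.T.obj X) Y ≫ prec (P.T.δ.app X) (P.T.obj Y) ≫ (P.adj.iso X (P.T.obj Y)).hom =
      (P.adj.iso X Y).hom ≫ post X (P.coactF Y) := by
  rw [← iso_iso_post_μ, InternalAdjunction.mapT, InternalHomIso.mapT, Category.assoc,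
    Iso.inv_hom_id_assoc, coactF, post_comp, ← Category.assoc (Iso.hom _),
    InternalHomIso.at'_post, Category.assoc]

theorem mapT_prec_chiefIso (X : C) :
    P.adj.mapT P.chief.obj X ≫ prec P.chief.ρ (P.T.obj X) ≫ (P.chiefIso (P.T.obj X)).hom =
      (P.chiefIso X).hom ≫ P.coactF X := by
  change P.adj.mapT (P.T.obj (𝟙_ C)) X ≫ prec (P.T.δ.app (𝟙_ C)) (P.T.obj X) ≫
    (P.adj.iso (𝟙_ C) (P.T.obj X)).hom ≫ _ = ((P.adj.iso (𝟙_ C) X).hom ≫ _) ≫ _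
  rw [reassoc_of% P.mapT_prec_δ_iso (𝟙_ C) X, post_unitIsoSelf, Category.assoc]

theorem μ_naturality {X Y : C} (f : X ⟶ Y) :
    P.F.map (P.F.map f) ≫ P.F.μ.app Y = P.F.μ.app X ≫ P.F.map f :=
  P.F.μ.naturality f

/-- `coactF` is the Kleisli extension of the unit `X ⟶ FTX`, hence a morphism of free `F`-modules.
-/
theorem μ_coactF (X : C) :
    P.F.μ.app X ≫ P.coactF X = P.F.map (P.coactF X) ≫ P.F.μ.app (P.T.obj X) := by
  rw [coactF, ← reassoc_of% P.μ_naturality, Functor.map_comp, Category.assoc, P.F.assoc]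

/-- `coactF` is `C`-natural. -/
theorem mapT_mapF_prec_coactF (X Y : C) :
    P.adj.mapT X Y ≫ P.adj.mapF (P.T.obj X) (P.T.obj Y) ≫
        prec (P.coactF X) (P.F.obj (P.T.obj Y)) =
      P.adj.mapF X Y ≫ post (P.F.obj X) (P.coactF Y) := by
  rw [coactF, prec_comp, reassoc_of% P.mapF_prec_μ, ← prec_post,
    reassoc_of% P.adj.homIso.mapF_prec, coactF, post_comp,
    reassoc_of% P.adj.homIso.mapF_post, ← P.adj.homIso.mapT_mapF_prec_unit]
  simp only [Category.assoc]

variable [HasEqualizers C]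

theorem inclR_eq (X : P.Comodule) : P.inclR X = P.γT P.chief X ≫ (P.chiefIso X.obj).hom := rfl

instance (X : P.Comodule) : Mono (P.inclR X) := by
  rw [inclR_eq]; infer_instance

/-- The equation defining `[T𝟙, X]_T`, carried along `[T𝟙, -] ≅ F`. Together with `liftR` it
exhibits `RX` as the equaliser of `Fρ` and `coactF`. -/
theorem inclR_condition (X : P.Comodule) :
    P.inclR X ≫ P.F.map X.ρ = P.inclR X ≫ P.coactF X.obj := by
  rw [inclR_eq, Category.assoc, ← post_chiefIso, reassoc_of% P.γT_condition P.chief X,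
    mapT_prec_chiefIso, Category.assoc]

/-- The lift to `[T 𝟙, X]_T` of a morphism into `F X`. -/
def liftR {W : C} (X : P.Comodule) (k : W ⟶ P.F.obj X.obj)
    (h : k ≫ P.F.map X.ρ = k ≫ P.coactF X.obj) : W ⟶ P.homT P.chief X :=
  P.liftT (k ≫ (P.chiefIso X.obj).inv) (by
    rw [← cancel_mono (P.chiefIso (P.T.obj X.obj)).hom]
    simp only [Category.assoc]
    rw [post_chiefIso, mapT_prec_chiefIso, Iso.inv_hom_id_assoc, Iso.inv_hom_id_assoc]
    exact h)

@[simp]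
theorem liftR_inclR {W : C} (X : P.Comodule) (k : W ⟶ P.F.obj X.obj) (h) :
    P.liftR X k h ≫ P.inclR X = k := by
  simp [liftR, inclR_eq, reassoc_of% P.liftT_γT]

/-- The structure morphism of `R X`, the restriction of the one of `F X`. -/
def θR (X : P.Comodule) : P.F.obj (P.homT P.chief X) ⟶ P.homT P.chief X :=
  P.liftR X (P.F.map (P.inclR X) ≫ P.F.μ.app X.obj) (by
    simp only [Category.assoc]
    -- Both `Fρ` and `coactF` are module morphisms between free modules, so `μ` restricts to their
    -- equaliser.
    rw [μ_coactF, ← μ_naturality, ← Functor.map_comp_assoc, inclR_condition,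
      Functor.map_comp_assoc])

@[simp]
theorem θR_inclR (X : P.Comodule) :
    P.θR X ≫ P.inclR X = P.F.map (P.inclR X) ≫ P.F.μ.app X.obj :=
  P.liftR_inclR _ _ _

/-- The contramodule `R X = [T 𝟙, X]_T`. -/
def objR (X : P.Comodule) : P.Contramodule where
  A := P.homT P.chief X
  a := P.θR X
  unit := by
    rw [← cancel_mono (P.inclR X), Category.assoc, θR_inclR]
    have h : P.inclR X ≫ P.F.η.app _ = P.F.η.app _ ≫ P.F.map (P.inclR X) :=
      P.F.η.naturality (P.inclR X)
    rw [← reassoc_of% h, P.F.left_unit]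
    simp
  assoc := by
    rw [← cancel_mono (P.inclR X), Category.assoc, Category.assoc, θR_inclR,
      ← Functor.map_comp_assoc, θR_inclR, Functor.map_comp_assoc, P.F.assoc,
      ← reassoc_of% P.μ_naturality]

/-- The inclusion of `R X` into `F X`. -/
def inclObjR (X : P.Comodule) : (P.objR X).obj ⟶ P.F.obj X.obj := P.inclR X

instance (X : P.Comodule) : Mono (P.inclObjR X) := inferInstanceAs (Mono (P.inclR X))

theorem inclObjR_condition (X : P.Comodule) :
    P.inclObjR X ≫ P.F.map X.ρ = P.inclObjR X ≫ P.coactF X.obj :=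
  P.inclR_condition X

theorem θ_inclObjR (X : P.Comodule) :
    (P.objR X).θ ≫ P.inclObjR X = P.F.map (P.inclObjR X) ≫ P.F.μ.app X.obj :=
  P.θR_inclR X

theorem exists_inclObjR {W : C} (X : P.Comodule) (k : W ⟶ P.F.obj X.obj)
    (h : k ≫ P.F.map X.ρ = k ≫ P.coactF X.obj) :
    ∃ l : W ⟶ (P.objR X).obj, l ≫ P.inclObjR X = k :=
  ⟨P.liftR X k h, P.liftR_inclR X k h⟩

/-- As a right adjoint, `[A, -]` preserves the equaliser `RX`. -/
theorem exists_post_inclObjR {W A : C} (X : P.Comodule) (k : W ⟶ hom A (P.F.obj X.obj))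
    (h : k ≫ post A (P.F.map X.ρ) = k ≫ post A (P.coactF X.obj)) :
    ∃ l : W ⟶ hom A (P.objR X).obj, l ≫ post A (P.inclObjR X) = k := by
  rw [comp_post_eq_curry, comp_post_eq_curry] at h
  obtain ⟨l, hl⟩ := P.exists_inclObjR X _ (MonoidalClosed.curry_injective h)
  refine ⟨MonoidalClosed.curry l, ?_⟩
  rw [comp_post_eq_curry, MonoidalClosed.uncurry_curry, hl, MonoidalClosed.curry_uncurry]

/-- The lifting criterion for `[X, RY]^F`: `h` gives a lift to `[X, RY]`, and `h'` is its
contramodule equation seen in `FY`, where the structure morphism of `RY` becomes `μ`. -/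
theorem exists_homF_objR {W : C} (X : P.Contramodule) (Y : P.Comodule)
    (k : W ⟶ hom X.obj (P.F.obj Y.obj))
    (h : k ≫ post X.obj (P.F.map Y.ρ) = k ≫ post X.obj (P.coactF Y.obj))
    (h' : k ≫ prec X.θ (P.F.obj Y.obj) =
      k ≫ P.adj.mapF X.obj (P.F.obj Y.obj) ≫ post (P.F.obj X.obj) (P.F.μ.app Y.obj)) :
    ∃ l : W ⟶ P.homF X (P.objR Y),
      l ≫ P.γF X (P.objR Y) ≫ post X.obj (P.inclObjR Y) = k := by
  obtain ⟨l, hl⟩ := P.exists_post_inclObjR Y k h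
  refine ⟨P.liftF (Y := P.objR Y) l ?_, ?_⟩
  · rw [← cancel_mono (post _ (P.inclObjR Y)), Category.assoc]
    rw [prec_post, reassoc_of% hl, h', Category.assoc, Category.assoc, ← post_comp, θ_inclObjR,
      post_comp, reassoc_of% P.adj.homIso.mapF_post, reassoc_of% hl]
  · rw [reassoc_of% P.liftF_γF, hl]

/-- The inclusion of `[X, R Y]^F` into `[X, F Y]`. -/
def inclHomF (X : P.Contramodule) (Y : P.Comodule) :
    P.homF X (P.objR Y) ⟶ hom X.obj (P.F.obj Y.obj) :=
  P.γF X (P.objR Y) ≫ post X.obj (P.inclObjR Y)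

instance (X : P.Contramodule) (Y : P.Comodule) : Mono (P.inclHomF X Y) := by
  have : Mono (post X.obj (P.inclObjR Y)) := inferInstance
  exact mono_comp (P.γF X (P.objR Y)) (post X.obj (P.inclObjR Y))

theorem compF_inclHomF (X X' : P.Contramodule) (Y : P.Comodule) :
    P.compF X X' (P.objR Y) ≫ P.inclHomF X Y =
      (P.γF X X' ⊗ₘ P.inclHomF X' Y) ≫ icomp X.obj X'.obj (P.F.obj Y.obj) := by
  rw [inclHomF, reassoc_of% P.compF_γF]
  have h : icomp X.obj X'.obj (P.objR Y).obj ≫ post X.obj (P.inclObjR Y) =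
    (hom X.obj X'.obj ◁ post X'.obj (P.inclObjR Y)) ≫ icomp X.obj X'.obj (P.F.obj Y.obj) :=
    icomp_post _ _ _
  rw [h]
  exact tensorHom_comp_whiskerLeft_assoc _ _ _ _

/-- The equaliser condition combines the comodule equation of `[X, Y]_T` with `C`-naturality of
`coactF`; the module condition is `C`-naturality of `μ`. -/
theorem exists_mapR (X Y : P.Comodule) :
    ∃ l : P.homT X Y ⟶ P.homF (P.objR X) (P.objR Y),
      l ≫ P.inclHomF (P.objR X) Y =
        P.γT X Y ≫ P.adj.mapF X.obj Y.obj ≫ prec (P.inclObjR X) (P.F.obj Y.obj) := by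
  refine P.exists_homF_objR (P.objR X) Y _ ?_ ?_
  · simp only [Category.assoc]
    rw [prec_post, reassoc_of% P.adj.homIso.mapF_post, reassoc_of% P.γT_condition X Y,
      ← reassoc_of% P.adj.homIso.mapF_prec, ← prec_comp, inclObjR_condition, prec_comp,
      reassoc_of% P.mapT_mapF_prec_coactF, prec_post]
  · simp only [Category.assoc]
    rw [← prec_comp, θ_inclObjR, prec_comp, reassoc_of% P.mapF_prec_μ,
      ← reassoc_of% P.adj.homIso.mapF_prec, prec_post]

/-- The action of `R` on hom objects. -/
def mapR (X Y : P.Comodule) : P.homT X Y ⟶ P.homF (P.objR X) (P.objR Y) :=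
  (P.exists_mapR X Y).choose

theorem mapR_inclHomF (X Y : P.Comodule) :
    P.mapR X Y ≫ P.inclHomF (P.objR X) Y =
      P.γT X Y ≫ P.adj.mapF X.obj Y.obj ≫ prec (P.inclObjR X) (P.F.obj Y.obj) :=
  (P.exists_mapR X Y).choose_spec

/-- `mapR` is compatible with composition after a morphism into `[-, R Y]`. -/
theorem tensor_mapR_icomp (A : C) (X Y : P.Comodule) {W : C} (k : W ⟶ hom A (P.objR X).obj) :
    (k ⊗ₘ (P.mapR X Y ≫ P.inclHomF (P.objR X) Y)) ≫
        icomp A (P.objR X).obj (P.F.obj Y.obj) =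
      ((k ≫ post A (P.inclObjR X)) ⊗ₘ (P.γT X Y ≫ P.adj.mapF X.obj Y.obj)) ≫
        icomp A (P.F.obj X.obj) (P.F.obj Y.obj) := by
  rw [mapR_inclHomF, ← Category.assoc, ← tensorHom_comp_whiskerRight_assoc, icomp_mid,
    tensorHom_comp_whiskerLeft_assoc]

/-- The enriched functor `R`. -/
def functorR : EnrichedFunctor C P.Comodule P.Contramodule where
  obj := P.objR
  map := P.mapR
  map_id X := by
    change P.idT X ≫ P.mapR X X = P.idF (P.objR X)
    rw [← cancel_mono (P.inclHomF (P.objR X) X), Category.assoc, mapR_inclHomF,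
      reassoc_of% P.idT_γT, reassoc_of% P.adj.mapF_id, inclHomF, reassoc_of% P.idF_γF]
    -- Both sides are the global section that names the inclusion of `RX`.
    exact (iid_prec (P.inclObjR X)).trans (iid_post (P.inclObjR X)).symm
  map_comp X Y Z := by
    change P.compT X Y Z ≫ P.mapR X Z =
      (P.mapR X Y ⊗ₘ P.mapR Y Z) ≫ P.compF (P.objR X) (P.objR Y) (P.objR Z)
    rw [← cancel_mono (P.inclHomF (P.objR X) Z), Category.assoc, mapR_inclHomF,
      reassoc_of% P.compT_γT, reassoc_of% P.adj.mapF_comp, icomp_prec, Category.assoc,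
      compF_inclHomF, tensorHom_comp_tensorHom_assoc, tensorHom_comp_whiskerRight_assoc,
      tensorHom_comp_tensorHom_assoc]
    refine Eq.trans ?_ (P.tensor_mapR_icomp (P.objR X).obj Y Z
      (P.mapR X Y ≫ P.γF (P.objR X) (P.objR Y))).symm
    have h := P.mapR_inclHomF X Y
    rw [inclHomF] at h
    simp only [Category.assoc, h]

/-- The two carriers agree definitionally, so the transport is an identity. -/
theorem eqToHom_inclR (X : P.Comodule) (h : (P.objR X).obj = P.homT P.chief X) :
    eqToHom h ≫ P.inclR X = P.inclObjR X :=
  Category.id_comp (P.inclR X)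

theorem isComoduleHom_functorR : P.IsComoduleHom P.functorR where
  obj_eq _ := rfl
  θ_eq X :=
    have h := P.eqToHom_inclR X rfl
    (congrArg ((P.objR X).θ ≫ ·) h).trans ((P.θ_inclObjR X).trans
      (congrArg (fun t => P.F.map t ≫ P.F.μ.app X.obj) h.symm))
  map_eq X Y :=
    (congrArg (fun t => P.mapR X Y ≫ P.γF _ _ ≫ post _ t) (P.eqToHom_inclR Y rfl)).trans
      ((P.mapR_inclHomF X Y).trans (congrArg
        (fun t => P.γT X Y ≫ P.adj.mapF X.obj Y.obj ≫ prec t _) (P.eqToHom_inclR X rfl).symm))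

end ComonadMonadPair

/-- After uncurrying, precomposition with `f` becomes composition with `f ▷ W`, which is epi because
`- ⊗ W` is a left adjoint. -/
theorem mono_prec {X Y : C} (f : X ⟶ Y) [Epi f]
    (h : ∀ A : C, (tensorRight A).IsLeftAdjoint) (Z : C) : Mono (prec f Z) where
  right_cancellation {W} k l hkl := by
    apply MonoidalClosed.uncurry_injective
    have h' := congrArg MonoidalClosed.uncurry hkl
    rw [MonoidalClosed.uncurry_pre_app, MonoidalClosed.uncurry_pre_app] at h'
    have : Epi (f ▷ W) := inferInstanceAs (Epi ((tensorRight W).map f))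
    exact (cancel_epi _).1 h'

namespace ComonadMonadPair

variable (P : ComonadMonadPair C)

/-! ### The functor `L` -/

theorem δ_naturality {X Y : C} (f : X ⟶ Y) :
    P.T.map f ≫ P.T.δ.app Y = P.T.δ.app X ≫ P.T.map (P.T.map f) :=
  P.T.δ.naturality f

/-- This and `βL_δ` say that the parallel pair consists of morphisms of cofree comodules, so `Δ`
descends to the coequaliser. -/
theorem δL_δ (Y : P.Contramodule) :
    P.δL Y ≫ P.T.δ.app Y.obj = P.T.δ.app (P.F.obj Y.obj) ≫ P.T.map (P.δL Y) :=
  P.δ_naturality Y.θ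

theorem βL_δ (Y : P.Contramodule) :
    P.βL Y ≫ P.T.δ.app Y.obj = P.T.δ.app (P.F.obj Y.obj) ≫ P.T.map (P.βL Y) := by
  rw [βL, Category.assoc, δ_naturality, Functor.map_comp, ← Category.assoc, ← P.T.coassoc,
    Category.assoc]

theorem prec_βL_iso (X : P.Contramodule) (Y : C) :
    prec (P.βL X) Y ≫ (P.adj.iso (P.F.obj X.obj) Y).hom =
      (P.adj.iso X.obj Y).hom ≫ P.adj.mapF X.obj (P.F.obj Y) ≫
        post (P.F.obj X.obj) (P.F.μ.app Y) :=
  P.prec_δ_counit_iso X.obj Y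

/-- `βL` is `C`-natural. -/
theorem mapF_mapT_post_βL (X Y : P.Contramodule) :
    P.adj.mapF X.obj Y.obj ≫ P.adj.mapT (P.F.obj X.obj) (P.F.obj Y.obj) ≫
        post (P.T.obj (P.F.obj X.obj)) (P.βL Y) =
      P.adj.mapT X.obj Y.obj ≫ prec (P.βL X) (P.T.obj Y.obj) := by
  have h := P.δ_natural (P.F.obj X.obj) (P.F.obj Y.obj)
  rw [βL, post_comp, reassoc_of% h, prec_post, reassoc_of% P.adj.homIso.mapT_post,
    reassoc_of% P.adj.homIso.mapF_mapT_post_counit, βL, prec_comp,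
    reassoc_of% P.adj.homIso.mapT_prec]

variable [HasCoequalizers C]

/-- The projection from `T Y` to the underlying object of `L Y`. -/
abbrev projL (Y : P.Contramodule) : P.T.obj Y.obj ⟶ coequalizer (P.δL Y) (P.βL Y) :=
  coequalizer.π (P.δL Y) (P.βL Y)

/-- The structure morphism of `L Y`, induced by the one of `T Y`. -/
def ρL (Y : P.Contramodule) :
    coequalizer (P.δL Y) (P.βL Y) ⟶ P.T.obj (coequalizer (P.δL Y) (P.βL Y)) :=
  coequalizer.desc (P.T.δ.app Y.obj ≫ P.T.map (P.projL Y)) (by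
    rw [reassoc_of% P.δL_δ, reassoc_of% P.βL_δ, ← Functor.map_comp, coequalizer.condition,
      Functor.map_comp])

theorem projL_ρL (Y : P.Contramodule) :
    P.projL Y ≫ P.ρL Y = P.T.δ.app Y.obj ≫ P.T.map (P.projL Y) :=
  coequalizer.π_desc _ _

/-- The comodule `L Y`. -/
def objL (Y : P.Contramodule) : P.Comodule where
  A := coequalizer (P.δL Y) (P.βL Y)
  a := P.ρL Y
  counit := by
    rw [← cancel_epi (P.projL Y), reassoc_of% P.projL_ρL]
    have h : P.T.map (P.projL Y) ≫ P.T.ε.app _ = P.T.ε.app _ ≫ P.projL Y :=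
      P.T.ε.naturality (P.projL Y)
    rw [h, reassoc_of% P.T.left_counit Y.obj]
    simp
  coassoc := by
    rw [← cancel_epi (P.projL Y), reassoc_of% P.projL_ρL, reassoc_of% P.projL_ρL,
      ← Functor.map_comp, projL_ρL, δ_naturality, Functor.map_comp, reassoc_of% P.T.coassoc]

/-- The projection from `T Y` to `L Y`. -/
def projObjL (Y : P.Contramodule) : P.T.obj Y.obj ⟶ (P.objL Y).obj := P.projL Y

instance (Y : P.Contramodule) : Epi (P.projObjL Y) := inferInstanceAs (Epi (P.projL Y))

theorem projObjL_ρ (Y : P.Contramodule) :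
    P.projObjL Y ≫ (P.objL Y).ρ = P.T.δ.app Y.obj ≫ P.T.map (P.projObjL Y) :=
  P.projL_ρL Y

theorem δL_projObjL (Y : P.Contramodule) : P.δL Y ≫ P.projObjL Y = P.βL Y ≫ P.projObjL Y :=
  coequalizer.condition _ _

theorem projL_eqToHom (Y : P.Contramodule)
    (h : coequalizer (P.δL Y) (P.βL Y) = (P.objL Y).obj) :
    coequalizer.π (P.δL Y) (P.βL Y) ≫ eqToHom h = P.projObjL Y :=
  Category.comp_id (P.projL Y)

/-- The left adjoint `- ⊗ W` preserves the coequaliser `LX`, so `[LX, Z]` is an equaliser of maps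
out of `[TX, Z]`. -/
theorem exists_prec_projObjL [∀ A : C, (tensorRight A).IsLeftAdjoint] {W Z : C}
    (X : P.Contramodule) (k : W ⟶ hom (P.T.obj X.obj) Z)
    (h : k ≫ prec (P.δL X) Z = k ≫ prec (P.βL X) Z) :
    ∃ l : W ⟶ hom (P.objL X).obj Z, l ≫ prec (P.projObjL X) Z = k := by
  have h' := congrArg MonoidalClosed.uncurry h
  rw [MonoidalClosed.uncurry_pre_app, MonoidalClosed.uncurry_pre_app] at h'
  obtain ⟨l, hl⟩ := Cofork.IsColimit.desc'
    (isColimitOfHasCoequalizerOfPreservesColimit (tensorRight W) (P.δL X) (P.βL X)) _ h'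
  refine ⟨MonoidalClosed.curry (A := (P.objL X).obj) (Y := W) l, ?_⟩
  apply MonoidalClosed.uncurry_injective
  refine (MonoidalClosed.uncurry_pre_app _ _ _).trans ?_
  exact (congrArg (P.projObjL X ▷ W ≫ ·) (MonoidalClosed.uncurry_curry _)).trans hl

variable [HasEqualizers C]

/-- The inclusion of `[L X, Y]_T` into `[T X, Y]`. -/
def inclHomT (X : P.Contramodule) (Y : P.Comodule) :
    P.homT (P.objL X) Y ⟶ hom (P.T.obj X.obj) Y.obj :=
  P.γT (P.objL X) Y ≫ prec (P.projObjL X) Y.obj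

theorem compT_inclHomT (X : P.Contramodule) (Y Y' : P.Comodule) :
    P.compT (P.objL X) Y Y' ≫ P.inclHomT X Y' =
      (P.inclHomT X Y ⊗ₘ P.γT Y Y') ≫ icomp (P.T.obj X.obj) Y.obj Y'.obj := by
  rw [inclHomT, reassoc_of% P.compT_γT, icomp_prec, tensorHom_comp_whiskerRight_assoc, inclHomT]

/-- The comodule equation on `LX`, pulled back to `TX`, gives the equaliser condition for `RY`; the
relation `δ ≫ π = β ≫ π` gives the module equation. -/
theorem exists_homT_to_homF (X : P.Contramodule) (Y : P.Comodule) :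
    ∃ l : P.homT (P.objL X) Y ⟶ P.homF X (P.objR Y),
      l ≫ P.inclHomF X Y = P.inclHomT X Y ≫ (P.adj.iso X.obj Y.obj).hom := by
  refine P.exists_homF_objR X Y _ ?_ ?_
  · simp only [Category.assoc]
    rw [P.adj.homIso.at'_post, ← mapT_prec_δ_iso, inclHomT]
    simp only [Category.assoc]
    rw [← reassoc_of% P.adj.homIso.mapT_prec, ← reassoc_of% prec_comp, ← projObjL_ρ, prec_comp,
      reassoc_of% prec_post, reassoc_of% P.γT_condition, Category.assoc]
  · simp only [Category.assoc]
    rw [P.adj.homIso.at'_prec, ← prec_βL_iso, inclHomT]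
    simp only [Category.assoc]
    rw [← Category.assoc (prec _ _), ← prec_comp, ← Category.assoc (prec _ _), ← prec_comp,
      ← δL_projObjL, δL]

variable [∀ A : C, (tensorRight A).IsLeftAdjoint]

instance (Y : P.Contramodule) (Z : C) : Mono (prec (P.projObjL Y) Z) :=
  mono_prec (P.projObjL Y) inferInstance Z

instance (X : P.Contramodule) (Y : P.Comodule) : Mono (P.inclHomT X Y) :=
  mono_comp (P.γT (P.objL X) Y) (prec (P.projObjL X) Y.obj)

/-- The lifting criterion for `[LX, Y]_T`, dual to `exists_homF_objR`. The comodule equation may be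
tested on `TX`, since precomposition with `π_X` is monic. -/
theorem exists_homT_objL {W : C} (X : P.Contramodule) (Y : P.Comodule)
    (k : W ⟶ hom (P.T.obj X.obj) Y.obj)
    (h : k ≫ prec (P.δL X) Y.obj = k ≫ prec (P.βL X) Y.obj)
    (h' : k ≫ post (P.T.obj X.obj) Y.ρ =
      k ≫ P.adj.mapT (P.T.obj X.obj) Y.obj ≫ prec (P.T.δ.app X.obj) (P.T.obj Y.obj)) :
    ∃ l : W ⟶ P.homT (P.objL X) Y, l ≫ P.inclHomT X Y = k := by
  obtain ⟨l, hl⟩ := P.exists_prec_projObjL X k h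
  refine ⟨P.liftT l ?_, ?_⟩
  · rw [← cancel_mono (prec (P.projObjL X) _), Category.assoc, ← prec_post, reassoc_of% hl, h',
      Category.assoc, Category.assoc, ← prec_comp, projObjL_ρ, prec_comp,
      reassoc_of% P.adj.homIso.mapT_prec, reassoc_of% hl]
  · rw [inclHomT, reassoc_of% P.liftT_γT, hl]

/-- Compatibility with `δ` and `β` combines the module equation of `[X, Y]^F` with `C`-naturality of
`β`; the comodule equation is `C`-naturality of `Δ`. -/
theorem exists_mapL (X Y : P.Contramodule) :
    ∃ l : P.homF X Y ⟶ P.homT (P.objL X) (P.objL Y),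
      l ≫ P.inclHomT X (P.objL Y) =
        P.γF X Y ≫ P.adj.mapT X.obj Y.obj ≫ post (P.T.obj X.obj) (P.projObjL Y) := by
  refine P.exists_homT_objL X (P.objL Y) _ ?_ ?_
  · simp only [Category.assoc]
    rw [← prec_post, δL, reassoc_of% P.adj.homIso.mapT_prec, reassoc_of% P.γF_condition X Y,
      ← reassoc_of% P.adj.homIso.mapT_post, ← post_comp, ← prec_post,
      ← reassoc_of% P.mapF_mapT_post_βL, ← post_comp, ← δL_projObjL, δL]
  · simp only [Category.assoc]
    have h := P.δ_natural X.obj Y.obj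
    rw [← post_comp, projObjL_ρ, post_comp, reassoc_of% h, prec_post,
      reassoc_of% P.adj.homIso.mapT_post]

/-- The action of `L` on hom objects. -/
def mapL (X Y : P.Contramodule) : P.homF X Y ⟶ P.homT (P.objL X) (P.objL Y) :=
  (P.exists_mapL X Y).choose

theorem mapL_inclHomT (X Y : P.Contramodule) :
    P.mapL X Y ≫ P.inclHomT X (P.objL Y) =
      P.γF X Y ≫ P.adj.mapT X.obj Y.obj ≫ post (P.T.obj X.obj) (P.projObjL Y) :=
  (P.exists_mapL X Y).choose_spec

/-- `mapL` is compatible with composition with a morphism into `[L X, -]`. -/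
theorem mapL_tensor_icomp (X X' : P.Contramodule) {W : C} (Z : C)
    (k : W ⟶ hom (P.objL X').obj Z) :
    ((P.mapL X X' ≫ P.inclHomT X (P.objL X')) ⊗ₘ k) ≫
        icomp (P.T.obj X.obj) (P.objL X').obj Z =
      ((P.γF X X' ≫ P.adj.mapT X.obj X'.obj) ⊗ₘ (k ≫ prec (P.projObjL X') Z)) ≫
        icomp (P.T.obj X.obj) (P.T.obj X'.obj) Z := by
  rw [mapL_inclHomT, ← Category.assoc, ← tensorHom_comp_whiskerRight_assoc, icomp_mid,
    tensorHom_comp_whiskerLeft_assoc]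

/-- The enriched functor `L`. -/
def functorL : EnrichedFunctor C P.Contramodule P.Comodule where
  obj := P.objL
  map := P.mapL
  map_id X := by
    change P.idF X ≫ P.mapL X X = P.idT (P.objL X)
    rw [← cancel_mono (P.inclHomT X (P.objL X)), Category.assoc, mapL_inclHomT,
      reassoc_of% P.idF_γF, reassoc_of% P.adj.mapT_id, inclHomT, reassoc_of% P.idT_γT]
    exact (iid_post (P.projObjL X)).trans (iid_prec (P.projObjL X)).symm
  map_comp X Y Z := by
    change P.compF X Y Z ≫ P.mapL X Z =
      (P.mapL X Y ⊗ₘ P.mapL Y Z) ≫ P.compT (P.objL X) (P.objL Y) (P.objL Z)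
    rw [← cancel_mono (P.inclHomT X (P.objL Z)), Category.assoc, mapL_inclHomT,
      reassoc_of% P.compF_γF, reassoc_of% P.adj.mapT_comp, icomp_post, Category.assoc,
      compT_inclHomT, tensorHom_comp_tensorHom_assoc, tensorHom_comp_whiskerLeft_assoc,
      tensorHom_comp_tensorHom_assoc]
    refine Eq.trans ?_ (P.mapL_tensor_icomp X Y (P.objL Z).obj
      (P.mapL Y Z ≫ P.γT (P.objL Y) (P.objL Z))).symm
    have h := P.mapL_inclHomT Y Z
    rw [inclHomT] at h
    simp only [Category.assoc, h]

theorem isContratensor_functorL : P.IsContratensor P.functorL where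
  obj_eq _ := rfl
  ρ_eq Y :=
    have h := P.projL_eqToHom Y rfl
    (congrArg (· ≫ (P.objL Y).ρ) h).trans ((P.projObjL_ρ Y).trans
      (congrArg (fun t => P.T.δ.app Y.obj ≫ P.T.map t) h.symm))
  map_eq X Y :=
    (congrArg (fun t => P.mapL X Y ≫ P.γT _ _ ≫ prec t _) (P.projL_eqToHom X rfl)).trans
      ((P.mapL_inclHomT X Y).trans (congrArg
        (fun t => P.γF X Y ≫ P.adj.mapT X.obj Y.obj ≫ post _ t) (P.projL_eqToHom Y rfl).symm))

/-! ### The adjunction -/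

/-- The converse exchange: the module equation gives descent to `LX`, and the equaliser condition on
`RY` gives the comodule equation. -/
theorem exists_homF_to_homT (X : P.Contramodule) (Y : P.Comodule) :
    ∃ l : P.homF X (P.objR Y) ⟶ P.homT (P.objL X) Y,
      l ≫ P.inclHomT X Y = P.inclHomF X Y ≫ (P.adj.iso X.obj Y.obj).inv := by
  refine P.exists_homT_objL X Y _ ?_ ?_
  · rw [← cancel_mono (P.adj.iso (P.F.obj X.obj) Y.obj).hom]
    simp only [Category.assoc]
    rw [prec_βL_iso, δL, ← P.adj.homIso.at'_prec, Iso.inv_hom_id_assoc, Iso.inv_hom_id_assoc,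
      inclHomF]
    simp only [Category.assoc]
    rw [← prec_post, reassoc_of% P.γF_condition, ← reassoc_of% P.adj.homIso.mapF_post,
      ← post_comp, ← post_comp, θ_inclObjR]
  · rw [← cancel_mono (P.adj.iso X.obj (P.T.obj Y.obj)).hom]
    simp only [Category.assoc]
    rw [mapT_prec_δ_iso, ← P.adj.homIso.at'_post, Iso.inv_hom_id_assoc, Iso.inv_hom_id_assoc,
      inclHomF]
    simp only [Category.assoc]
    rw [← post_comp, ← post_comp, inclObjR_condition]

/-- The isomorphism `[L X, Y]_T ≅ [X, R Y]^F`: both are the same subobject of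
`[T X, Y] ≅ [X, F Y]`. -/
def adjIso (X : P.Contramodule) (Y : P.Comodule) :
    P.homT (P.objL X) Y ≅ P.homF X (P.objR Y) where
  hom := (P.exists_homT_to_homF X Y).choose
  inv := (P.exists_homF_to_homT X Y).choose
  hom_inv_id := by
    rw [← cancel_mono (P.inclHomT X Y), Category.assoc, (P.exists_homF_to_homT X Y).choose_spec,
      reassoc_of% (P.exists_homT_to_homF X Y).choose_spec]
    simp
  inv_hom_id := by
    rw [← cancel_mono (P.inclHomF X Y), Category.assoc, (P.exists_homT_to_homF X Y).choose_spec,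
      reassoc_of% (P.exists_homF_to_homT X Y).choose_spec]
    simp

theorem adjIso_inclHomF (X : P.Contramodule) (Y : P.Comodule) :
    (P.adjIso X Y).hom ≫ P.inclHomF X Y =
      P.inclHomT X Y ≫ (P.adj.iso X.obj Y.obj).hom :=
  (P.exists_homT_to_homF X Y).choose_spec

/-- Inside `[X', FY]` this is `C`-naturality of `κ` in the first variable; `mapL_tensor_icomp` turns
the action of `L` into that of `T`. -/
theorem adjIso_natural_left (X' X : P.Contramodule) (Y : P.Comodule) :
    (P.mapL X' X ▷ _) ≫ P.compT (P.objL X') (P.objL X) Y ≫ (P.adjIso X' Y).hom =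
      (_ ◁ (P.adjIso X Y).hom) ≫ P.compF X' X (P.objR Y) := by
  rw [← cancel_mono (P.inclHomF X' Y)]
  simp only [Category.assoc]
  rw [adjIso_inclHomF, reassoc_of% P.compT_inclHomT, compF_inclHomF,
    whiskerRight_comp_tensorHom_assoc, whiskerLeft_comp_tensorHom_assoc, adjIso_inclHomF,
    reassoc_of% P.mapL_tensor_icomp, ← inclHomT, ← tensorHom_comp_whiskerLeft_assoc,
    ← P.adj.natural_left, tensorHom_comp_whiskerRight_assoc]

theorem adjIso_natural_right (X : P.Contramodule) (Y Y' : P.Comodule) :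
    P.compT (P.objL X) Y Y' ≫ (P.adjIso X Y').hom =
      ((P.adjIso X Y).hom ⊗ₘ P.mapR Y Y') ≫ P.compF X (P.objR Y) (P.objR Y') := by
  rw [← cancel_mono (P.inclHomF X Y')]
  simp only [Category.assoc]
  rw [adjIso_inclHomF, reassoc_of% P.compT_inclHomT, compF_inclHomF, P.adj.natural_right,
    tensorHom_comp_tensorHom_assoc, tensorHom_comp_tensorHom_assoc, tensor_mapR_icomp,
    Category.assoc, ← inclHomF, adjIso_inclHomF]

/-- The enriched adjunction `L ⊣ R`. -/
def enrichedAdjunction : EnrichedAdjunction C P.functorL P.functorR where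
  homIso := P.adjIso
  natural_left := P.adjIso_natural_left
  natural_right := P.adjIso_natural_right

end ComonadMonadPair
end CoContra
end

theorem mainTheorem2 {C : Type u} [Category.{v} C] [MonoidalCategory C] [MonoidalClosed C]
    [HasLimits C] (P : CoContra.ComonadMonadPair C) :
    ∃ R : EnrichedFunctor C P.Comodule P.Contramodule,
      P.IsComoduleHom R ∧
      ∀ [HasColimits C], (∀ A : C, (tensorRight A).IsLeftAdjoint) →
        ∃ L : EnrichedFunctor C P.Contramodule P.Comodule,
          P.IsContratensor L ∧ Nonempty (CoContra.EnrichedAdjunction C L R) :=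
  -- The biclosedness hypothesis enters the local context here and is then found by instance search.
  ⟨P.functorR, P.isComoduleHom_functorR, fun _ =>
    ⟨P.functorL, P.isContratensor_functorL, ⟨P.enrichedAdjunction⟩⟩⟩
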